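/- Let $L\ge 1$ and $\Omega=\{1,\dots,L\}$. Let $F,\tilde F\in\mathbb R^{L\times L}$ be (row-)stochastic matrices. Let $S\in\mathbb R^{L\times L}$ be substochastic ($S_{ij}\ge 0$ and $\sum_j S_{ij}\le 1$ for all $i,j$) and irreducible (for all $i,j\in\Omega$ there is $k\ge 1$ with $(S^k)_{ij}>0$). Assume $F\ge S$ and $\tilde F\ge S$ entrywise. For $i\ne j$ in $\Omega$ let $$\mathbf Q_{ij}(S)=\mathbf P_i\big[\tau_j<\min\{\tau_i,\tau_\omega\}\big],$$ the probability being taken for the Markov chain $X$ on $\Omega\cup\{\omega\}$ started at $X_0=i$ with transition matrix $$S^\omega=\begin{pmatrix} S & e-Se\\ 0 & 1\end{pmatrix},$$ where $e$ is the vector of ones, $\omega$ is an added absorbing state, and $\tau_k=\min\{s>0: X_s=k\}$ (with $\min\emptyset=\infty$). Then each of the systems $\pi^{\mathsf T}F=\pi^{\mathsf T},\ \pi^{\mathsf T}e=1$ and $\tilde\pi^{\mathsf T}\tilde F=\tilde\pi^{\mathsf T},\ \tilde\pi^{\mathsf T}e=1$ has a unique solution in $\mathbb R^L$, denoted $\pi(F)$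 and $\pi(\tilde F)$ respectively; all entries of $\pi(F)$ and $\pi(\tilde F)$ are positive; $\mathbf Q_{ij}(S)>0$ for all $i\ne j$; and for every $m\in\Omega$ $$\big|\log\pi_m(\tilde F)-\log\pi_m(F)\big|\ \le\ \sum_{\substack{i,j\in\Omega\\ i\ne j}}\mathbf Q_{ij}(S)^{-1}\,\big|\tilde F_{ij}-F_{ij}\big| .$$ -/

import Mathlib

open MeasureTheory ProbabilityTheory

namespace MarkovPerturbation

/-- A real square matrix is substochastic if it is entrywise nonnegative and every row sum
is at most one. Stochastic matrices (`Matrix.rowStochastic`) are included. -/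
def IsSubstochastic {n : Type*} [Fintype n] (S : Matrix n n ℝ) : Prop :=
  (∀ i j, 0 ≤ S i j) ∧ ∀ i, ∑ j, S i j ≤ 1

/-- `p` solves `pᵀ F = pᵀ`, `pᵀ e = 1`. For irreducible stochastic `F` the solution is unique
and is the invariant distribution of `F`. -/
def IsInvariantDistribution {n : Type*} [Fintype n] (F : Matrix n n ℝ) (p : n → ℝ) : Prop :=
  Matrix.vecMul p F = p ∧ ∑ i, p i = 1

section Chain

variable {X : Type*} [Fintype X] [DecidableEq X]

/-- Row `x` of a stochastic matrix, as a probability mass function. -/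
noncomputable def rowPMF (P : Matrix X X ℝ) (hP : P ∈ Matrix.rowStochastic ℝ X) (x : X) :
    PMF X :=
  PMF.ofFintype (fun y => ENNReal.ofReal (P x y)) (by
    rw [← ENNReal.ofReal_sum_of_nonneg (fun y _ => Matrix.nonneg_of_mem_rowStochastic hP),
      Matrix.sum_row_of_mem_rowStochastic hP, ENNReal.ofReal_one])

variable [MeasurableSpace X] [DiscreteMeasurableSpace X]

/-- The one-step transition kernel of a stochastic matrix. -/
noncomputable def transitionKernel (P : Matrix X X ℝ) (hP : P ∈ Matrix.rowStochastic ℝ X) :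
    Kernel X X where
  toFun x := (rowPMF P hP x).toMeasure
  measurable' := Measurable.of_discrete

instance instIsMarkovKernelTransitionKernel (P : Matrix X X ℝ)
    (hP : P ∈ Matrix.rowStochastic ℝ X) : IsMarkovKernel (transitionKernel P hP) :=
  ⟨fun x => inferInstanceAs (IsProbabilityMeasure (rowPMF P hP x).toMeasure)⟩

/-- The transition from the history up to time `n` to the state at time `n + 1`: it depends on
the state at time `n` only. -/
noncomputable def historyKernel (P : Matrix X X ℝ) (hP : P ∈ Matrix.rowStochastic ℝ X) (n : ℕ) :
    Kernel ((k : Finset.Iic n) → X) X :=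
  (transitionKernel P hP).comap (fun h => h ⟨n, Finset.mem_Iic.2 le_rfl⟩)
    (measurable_pi_apply _)

instance instIsMarkovKernelHistoryKernel (P : Matrix X X ℝ)
    (hP : P ∈ Matrix.rowStochastic ℝ X) (n : ℕ) : IsMarkovKernel (historyKernel P hP n) :=
  inferInstanceAs (IsMarkovKernel ((transitionKernel P hP).comap _ _))

/-- The law, on the space of trajectories `ℕ → X`, of the Markov chain with transition matrix
`P` started at `x₀`. -/
noncomputable def chainLaw (P : Matrix X X ℝ) (hP : P ∈ Matrix.rowStochastic ℝ X) (x₀ : X) :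
    Measure (ℕ → X) :=
  Kernel.traj (X := fun _ => X) (historyKernel P hP) 0 (fun _ => x₀)

end Chain

/-- The first return time `τ_k = min {s > 0 : x_s = k}` of a trajectory, with value `⊤` if `k` is
never visited at a positive time. -/
noncomputable def returnTime {X : Type*} (k : X) (x : ℕ → X) : WithTop ℕ :=
  hittingAfter (fun s (y : ℕ → X) => y s) {k} 1 x

section Killed

variable {L : ℕ}

/-- The augmented matrix `[[S, e - S e], [0, 1]]` on `Ω ∪ {ω}`, where `Ω = Fin L` and the absorbing
state `ω` is `Sum.inr ()`. -/
def augmented (S : Matrix (Fin L) (Fin L) ℝ) :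
    Matrix (Fin L ⊕ Unit) (Fin L ⊕ Unit) ℝ :=
  Matrix.fromBlocks S (Matrix.of fun i _ => 1 - ∑ j, S i j) 0 1

theorem augmented_mem_rowStochastic {S : Matrix (Fin L) (Fin L) ℝ} (hS : IsSubstochastic S) :
    augmented S ∈ Matrix.rowStochastic ℝ (Fin L ⊕ Unit) := by
  rw [Matrix.mem_rowStochastic_iff_sum]
  refine ⟨?_, ?_⟩
  · rintro (i | i) (j | j)
    · exact hS.1 i j
    · simpa [augmented] using hS.2 i
    · simp [augmented]
    · simp [augmented]
  · rintro (i | i) <;> simp [augmented]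

instance instDiscreteMeasurableSpaceAugmented : DiscreteMeasurableSpace (Fin L ⊕ Unit) :=
  ⟨fun _ => measurableSet_sum_iff.2 ⟨MeasurableSet.of_discrete, MeasurableSet.of_discrete⟩⟩

/-- `Q_ij(S) = P_i[τ_j < min {τ_i, τ_ω}](S^ω)`: the probability that the chain on `Ω ∪ {ω}` with
transition matrix `augmented S`, started at `i`, visits `j` before it returns to `i` and before it
is absorbed in `ω`. -/
noncomputable def Q (S : Matrix (Fin L) (Fin L) ℝ) (hS : IsSubstochastic S) (i j : Fin L) : ℝ :=
  (chainLaw (augmented S) (augmented_mem_rowStochastic hS) (Sum.inl i)).real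
    {x | returnTime (Sum.inl j) x < min (returnTime (Sum.inl i) x) (returnTime (Sum.inr ()) x)}

end Killed

end MarkovPerturbation

namespace MarkovPerturbation

/-! Let `p`, `p'` be the invariant distributions of `F`, `F'`. For `i ≠ j` let `y i j` be the
zero-sum solution of y(I - F) = e_j - e_i. Since p'(I - F) = p'(F' - F) and the rows of F' - F sum
to zero, p' - p is the sum over i ≠ j of p'_i (F'_ij - F_ij) `y i j`.

The key estimate, `exists_green`, is |(`y i j`)_m| ≤ p_m / (p_i Q_ij). Adding a multiple of `p`
makes the Green vector vanish at `i`; by the minimum principle its density with respect to `p` then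
lies between 0 and its value at `j`. Pairing it with truncated probabilities, for the chain killed
outside `S`, of hitting `j` before `i` bounds that value by 1 / (p_i Q_ij).

With C the right-hand side of the theorem and ρ = max p'/p, this gives |p'_m - p_m| ≤ ρ C p_m, hence
ρ(1 - C) ≤ 1, and log(p'_m / p_m) ≤ C/(1 - C) if C < 1. Every matrix on the segment from `F` to `F'`
dominates `S`, so the same weights serve along it: N equal steps give C/(1 - C/N), which tends to C.
-/

theorem isIrreducible_mono {n : Type*} {S F : Matrix n n ℝ} (hS : S.IsIrreducible)
    (h : ∀ i j, S i j ≤ F i j) : F.IsIrreducible := by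
  refine ⟨fun i j => (hS.nonneg i j).trans (h i j), fun i j => ?_⟩
  -- The length is carried along because `connected` asks for a path of positive length.
  have key : ∀ k (p : @Quiver.Path n S.toQuiver i k),
      ∃ q : @Quiver.Path n F.toQuiver i k,
        @Quiver.Path.length n F.toQuiver _ _ q = @Quiver.Path.length n S.toQuiver _ _ p := by
    intro k p
    induction p with
    | nil => exact ⟨@Quiver.Path.nil n F.toQuiver i, rfl⟩
    | cons p e ih =>
      obtain ⟨q, hq⟩ := ih
      exact ⟨@Quiver.Path.cons n F.toQuiver _ _ _ q ⟨lt_of_lt_of_le e.down (h _ _)⟩,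
        congrArg (· + 1) hq⟩
  obtain ⟨p, hp⟩ := hS.connected i j
  obtain ⟨q, hq⟩ := key j p
  exact ⟨q, lt_of_lt_of_eq hp hq.symm⟩

/-! ### Invariant vectors and Green vectors of irreducible stochastic matrices -/

section LinearAlgebra

variable {n : Type*} [Fintype n]

/-- A nonnegative vector that is excessive away from a point where it is positive is positive
everywhere. -/
theorem pos_of_vecMul_le {F : Matrix n n ℝ} (hF : F.IsIrreducible) {z : n → ℝ}
    (hz : ∀ k, 0 ≤ z k) {i : n} (hi : 0 < z i)
    (hle : ∀ k, k ≠ i → Matrix.vecMul z F k ≤ z k) (k : n) : 0 < z k := by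
  obtain ⟨p, -⟩ := hF.connected i k
  induction p with
  | nil => exact hi
  | @cons b c p e ih =>
    by_cases hc : c = i
    · rwa [hc]
    · refine lt_of_lt_of_le ?_ (hle c hc)
      refine lt_of_lt_of_le (mul_pos ih e.down) ?_
      exact Finset.single_le_sum (f := fun l => z l * F l c)
        (fun l _ => mul_nonneg (hz l) (hF.nonneg l c)) (Finset.mem_univ b)

theorem pos_or_eq_zero_of_vecMul_eq {F : Matrix n n ℝ} (hirr : F.IsIrreducible) {p : n → ℝ}
    (h0 : ∀ k, 0 ≤ p k) (hp : Matrix.vecMul p F = p) : (∀ k, 0 < p k) ∨ p = 0 := by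
  by_cases h : ∃ i, 0 < p i
  · obtain ⟨i, hi⟩ := h
    exact Or.inl (pos_of_vecMul_le hirr h0 hi fun k _ => (congrFun hp k).le)
  · push Not at h
    exact Or.inr (funext fun k => le_antisymm (h k) (h0 k))

variable [DecidableEq n]

theorem sum_vecMul_of_mem_rowStochastic {F : Matrix n n ℝ} (hF : F ∈ Matrix.rowStochastic ℝ n)
    (x : n → ℝ) : ∑ k, Matrix.vecMul x F k = ∑ k, x k := by
  simp only [Matrix.vecMul, dotProduct]
  rw [Finset.sum_comm]
  refine Finset.sum_congr rfl fun k _ => ?_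
  rw [← Finset.mul_sum, Matrix.sum_row_of_mem_rowStochastic hF, mul_one]

/-- The triangle inequality gives |p| ≤ |p|F entrywise, and both sides have the same total mass, so
|p| is invariant too. Then |p| + p and |p| - p are nonnegative invariant vectors, each positive
everywhere or zero. -/
theorem sign_of_vecMul_eq {F : Matrix n n ℝ} (hF : F ∈ Matrix.rowStochastic ℝ n)
    (hirr : F.IsIrreducible) {p : n → ℝ} (hp : Matrix.vecMul p F = p) :
    (∀ k, 0 < p k) ∨ p = 0 ∨ ∀ k, p k < 0 := by
  set q : n → ℝ := fun k => |p k| with hq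
  have hle : ∀ k ∈ Finset.univ, q k ≤ Matrix.vecMul q F k := by
    intro k _
    have : p k = ∑ l, p l * F l k := (congrFun hp k).symm
    rw [hq]
    simp only
    rw [this]
    refine (Finset.abs_sum_le_sum_abs _ _).trans (le_of_eq ?_)
    refine Finset.sum_congr rfl fun l _ => ?_
    rw [abs_mul, abs_of_nonneg (hirr.nonneg l k)]
  have hqF : Matrix.vecMul q F = q := by
    have := (Finset.sum_eq_sum_iff_of_le hle).1 (sum_vecMul_of_mem_rowStochastic hF q).symm
    exact funext fun k => (this k (Finset.mem_univ k)).symm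
  have h1 := pos_or_eq_zero_of_vecMul_eq hirr (p := q + p)
    (fun k => by simp only [Pi.add_apply, hq]; linarith [neg_abs_le (p k)])
    (by rw [Matrix.add_vecMul, hqF, hp])
  have h2 := pos_or_eq_zero_of_vecMul_eq hirr (p := q - p)
    (fun k => by simp only [Pi.sub_apply, hq]; linarith [le_abs_self (p k)])
    (by rw [Matrix.sub_vecMul, hqF, hp])
  rcases h1 with h1 | h1
  · refine Or.inl fun k => ?_
    have := h1 k
    simp only [Pi.add_apply, hq] at this
    by_contra hk
    rw [abs_of_nonpos (not_lt.1 hk)] at this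
    linarith
  · rcases h2 with h2 | h2
    · refine Or.inr (Or.inr fun k => ?_)
      have := h2 k
      simp only [Pi.sub_apply, hq] at this
      by_contra hk
      rw [abs_of_nonneg (not_lt.1 hk)] at this
      linarith
    · refine Or.inr (Or.inl (funext fun k => ?_))
      have e1 := congrFun h1 k
      have e2 := congrFun h2 k
      simp only [Pi.add_apply, Pi.sub_apply, Pi.zero_apply] at e1 e2 ⊢
      linarith

variable [Nonempty n]

theorem eq_zero_of_vecMul_eq_of_sum_eq_zero {F : Matrix n n ℝ}
    (hF : F ∈ Matrix.rowStochastic ℝ n) (hirr : F.IsIrreducible) {p : n → ℝ}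
    (hp : Matrix.vecMul p F = p) (hs : ∑ k, p k = 0) : p = 0 := by
  rcases sign_of_vecMul_eq hF hirr hp with h | h | h
  · exact absurd hs (Finset.sum_pos (fun k _ => h k) Finset.univ_nonempty).ne'
  · exact h
  · exact absurd hs (Finset.sum_neg (fun k _ => h k) Finset.univ_nonempty).ne

theorem IsInvariantDistribution.pos {F : Matrix n n ℝ}
    (hF : F ∈ Matrix.rowStochastic ℝ n) (hirr : F.IsIrreducible) {p : n → ℝ}
    (hp : IsInvariantDistribution F p) (k : n) : 0 < p k := by
  rcases sign_of_vecMul_eq hF hirr hp.1 with h | h | h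
  · exact h k
  · have := hp.2
    simp [h] at this
  · linarith [hp.2, Finset.sum_neg (fun k _ => h k) (Finset.univ_nonempty (α := n))]

theorem existsUnique_isInvariantDistribution {F : Matrix n n ℝ}
    (hF : F ∈ Matrix.rowStochastic ℝ n) (hirr : F.IsIrreducible) :
    ∃! p, IsInvariantDistribution F p := by
  have hdet : (1 - F).det = 0 := by
    refine Matrix.exists_mulVec_eq_zero_iff.1 ⟨1, one_ne_zero, ?_⟩
    rw [Matrix.sub_mulVec, Matrix.one_mulVec, hF.2, sub_self]
  obtain ⟨v, hv, hvF⟩ := Matrix.exists_vecMul_eq_zero_iff.2 hdet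
  rw [Matrix.vecMul_sub, Matrix.vecMul_one, sub_eq_zero] at hvF
  have hs : ∑ k, v k ≠ 0 := fun h =>
    hv (eq_zero_of_vecMul_eq_of_sum_eq_zero hF hirr hvF.symm h)
  refine ⟨(∑ k, v k)⁻¹ • v, ⟨?_, ?_⟩, ?_⟩
  · rw [Matrix.smul_vecMul, ← hvF]
  · simp only [Pi.smul_apply, smul_eq_mul]
    rw [← Finset.mul_sum, inv_mul_cancel₀ hs]
  · rintro q ⟨hq, hq1⟩
    refine sub_eq_zero.1 (eq_zero_of_vecMul_eq_of_sum_eq_zero hF hirr ?_ ?_)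
    · rw [Matrix.sub_vecMul, hq, Matrix.smul_vecMul, ← hvF]
    · simp only [Pi.sub_apply, Pi.smul_apply, smul_eq_mul]
      rw [Finset.sum_sub_distrib, hq1, ← Finset.mul_sum, inv_mul_cancel₀ hs, sub_self]

/-- The rank-one correction (∑ x) p makes x ↦ x - xF preserve total mass. A kernel vector of the
corrected map thus has zero sum and is invariant, hence zero; injectivity gives surjectivity in
finite dimension. -/
theorem exists_sub_vecMul_eq {F : Matrix n n ℝ} (hF : F ∈ Matrix.rowStochastic ℝ n)
    (hirr : F.IsIrreducible) {p : n → ℝ} (hp : IsInvariantDistribution F p) {w : n → ℝ}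
    (hw : ∑ k, w k = 0) : ∃ g : n → ℝ, ∑ k, g k = 0 ∧ g - Matrix.vecMul g F = w := by
  let T : (n → ℝ) →ₗ[ℝ] (n → ℝ) :=
    { toFun := fun x => x - Matrix.vecMul x F + (∑ k, x k) • p
      map_add' := fun x y => by
        simp only [Matrix.add_vecMul, Pi.add_apply, Finset.sum_add_distrib, add_smul]
        abel
      map_smul' := fun c x => by
        simp only [Matrix.smul_vecMul, Pi.smul_apply, smul_eq_mul, ← Finset.mul_sum,
          RingHom.id_apply, smul_add, smul_sub, mul_smul] }
  have hsum : ∀ x, ∑ k, T x k = ∑ k, x k := by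
    intro x
    change ∑ k, (x k - Matrix.vecMul x F k + (∑ l, x l) * p k) = _
    rw [Finset.sum_add_distrib, Finset.sum_sub_distrib, sum_vecMul_of_mem_rowStochastic hF,
      ← Finset.mul_sum, hp.2]
    ring
  have hT : ∀ x, ∑ k, x k = 0 → T x = x - Matrix.vecMul x F := by
    intro x hx
    change x - Matrix.vecMul x F + (∑ k, x k) • p = _
    rw [hx, zero_smul, add_zero]
  have hinj : Function.Injective T := by
    rw [← LinearMap.ker_eq_bot, LinearMap.ker_eq_bot']
    intro x hx
    have h0 : ∑ k, x k = 0 := by rw [← hsum x, hx]; simp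
    rw [hT x h0, sub_eq_zero] at hx
    exact eq_zero_of_vecMul_eq_of_sum_eq_zero hF hirr hx.symm h0
  obtain ⟨g, hg⟩ := LinearMap.injective_iff_surjective.1 hinj w
  have h0 : ∑ k, g k = 0 := by rw [← hsum g, hg, hw]
  exact ⟨g, h0, by rw [← hT g h0, hg]⟩

/-- Minimum principle for the density of a vector with respect to the invariant distribution. -/
theorem mul_le_mul_of_vecMul_le {F : Matrix n n ℝ} (hF : F ∈ Matrix.rowStochastic ℝ n)
    (hirr : F.IsIrreducible) {p : n → ℝ} (hp : IsInvariantDistribution F p) {g : n → ℝ} {i : n}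
    (hg : ∀ k, k ≠ i → Matrix.vecMul g F k ≤ g k) (k : n) : g i * p k ≤ g k * p i := by
  have hpos := hp.pos hF hirr
  obtain ⟨k₀, hk₀⟩ := Finite.exists_min fun k => g k / p k
  set t := g k₀ / p k₀ with ht
  have hge : ∀ k, t * p k ≤ g k := fun k => (le_div_iff₀ (hpos k)).1 (hk₀ k)
  -- Otherwise g - t p is nonnegative, positive at `i` and excessive elsewhere, hence positive
  -- everywhere, although it vanishes at the minimizer `k₀`.
  have hi : g i ≤ t * p i := by
    by_contra hlt
    have := pos_of_vecMul_le hirr (z := g - t • p) (i := i)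
      (fun k => sub_nonneg.2 (hge k)) (sub_pos.2 (not_le.1 hlt))
      (fun k hk => by
        rw [Matrix.sub_vecMul, Matrix.smul_vecMul, hp.1]
        exact sub_le_sub_right (hg k hk) _) k₀
    simp only [Pi.sub_apply, Pi.smul_apply, smul_eq_mul, ht] at this
    rw [div_mul_cancel₀ _ (hpos k₀).ne', sub_self] at this
    exact lt_irrefl _ this
  calc g i * p k ≤ t * p i * p k := mul_le_mul_of_nonneg_right hi (hpos k).le
    _ = t * p k * p i := by ring
    _ ≤ g k * p i := mul_le_mul_of_nonneg_right (hge k) (hpos i).le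

/-- `q` is approximated from below by one-step values at `i` of nonnegative functions that are
subharmonic for `S` away from `i` and `j`, vanish at `i`, and equal one at `j`. -/
def IsEscapeBound (S : Matrix n n ℝ) (i j : n) (q : ℝ) : Prop :=
  ∀ r < q, ∃ h : n → ℝ, (∀ k, 0 ≤ h k) ∧ h i = 0 ∧ h j = 1 ∧
    (∀ k, k ≠ i → k ≠ j → h k ≤ Matrix.mulVec S h k) ∧ r ≤ Matrix.mulVec S h i

/-- The minimum principle, applied to the Green vector with base point `i` and to its negative with
base point `j`, locates the extrema of its density; the test functions of `IsEscapeBound` control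
the maximum. -/
theorem exists_green {S F : Matrix n n ℝ} (hF : F ∈ Matrix.rowStochastic ℝ n)
    (hirr : F.IsIrreducible) (hSF : ∀ i j, S i j ≤ F i j) {p : n → ℝ}
    (hp : IsInvariantDistribution F p) {i j : n} (hij : i ≠ j) {q : ℝ}
    (hq : IsEscapeBound S i j q) :
    ∃ y : n → ℝ, ∑ k, y k = 0 ∧ y - Matrix.vecMul y F = Pi.single j 1 - Pi.single i 1 ∧
      ∀ k, |y k| * (p i * q) ≤ p k := by
  have hpos := hp.pos hF hirr
  obtain ⟨g, hg0, hg⟩ := exists_sub_vecMul_eq hF hirr hp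
    (w := Pi.single j 1 - Pi.single i 1) (by simp [Finset.sum_sub_distrib])
  -- Subtracting a multiple of `p` keeps the equation and normalizes the value at `i` to zero.
  set z : n → ℝ := g - (g i / p i) • p with hz
  have hzF : z - Matrix.vecMul z F = Pi.single j 1 - Pi.single i 1 := by
    rw [← hg, hz, Matrix.sub_vecMul, Matrix.smul_vecMul, hp.1]
    abel
  have hzFk : ∀ k, z k - Matrix.vecMul z F k =
      (Pi.single j 1 : n → ℝ) k - (Pi.single i 1 : n → ℝ) k := fun k => congrFun hzF k
  have hzi : z i = 0 := by
    simp only [hz, Pi.sub_apply, Pi.smul_apply, smul_eq_mul]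
    rw [div_mul_cancel₀ _ (hpos i).ne', sub_self]
  have hz0 : ∀ k, 0 ≤ z k := by
    intro k
    have := mul_le_mul_of_vecMul_le hF hirr hp (g := z) (i := i) (fun k hk => by
      have h1 := hzFk k
      rw [Pi.single_eq_of_ne hk] at h1
      have h2 : (0 : ℝ) ≤ (Pi.single j 1 : n → ℝ) k := by
        rw [Pi.single_apply]; split_ifs <;> norm_num
      linarith) k
    rw [hzi, zero_mul] at this
    exact nonneg_of_mul_nonneg_left this (hpos i)
  have hzj : ∀ k, z k * p j ≤ z j * p k := by
    intro k
    have := mul_le_mul_of_vecMul_le hF hirr hp (g := -z) (i := j) (fun k hk => by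
      have h1 := hzFk k
      rw [Pi.single_eq_of_ne hk] at h1
      have h2 : (0 : ℝ) ≤ (Pi.single i 1 : n → ℝ) k := by
        rw [Pi.single_apply]; split_ifs <;> norm_num
      rw [Matrix.neg_vecMul]
      simp only [Pi.neg_apply]
      linarith) k
    simp only [Pi.neg_apply] at this
    linarith
  have hcap : z j * (p i * q) ≤ p j := by
    rcases (hz0 j).eq_or_lt with h0 | h0
    · rw [← h0, zero_mul]; exact (hpos j).le
    have hc : 0 < z j * p i := mul_pos h0 (hpos i)
    suffices hs : q ≤ p j / (z j * p i) by
      rw [le_div_iff₀ hc] at hs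
      linarith
    refine le_of_forall_lt_imp_le_of_dense fun r hr => ?_
    obtain ⟨h, hh0, hhi, hhj, hsub, hrh⟩ := hq r hr
    have hSh : ∀ k, Matrix.mulVec S h k ≤ Matrix.mulVec F h k := fun k =>
      Finset.sum_le_sum fun l _ => mul_le_mul_of_nonneg_right (hSF k l) (hh0 l)
    have hdual : ∀ x : n → ℝ, ∑ k, x k * (h k - Matrix.mulVec F h k) =
        ∑ k, (x k - Matrix.vecMul x F k) * h k := by
      intro x
      have : ∑ k, x k * Matrix.mulVec F h k = ∑ k, Matrix.vecMul x F k * h k :=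
        Matrix.dotProduct_mulVec x F h
      simp only [mul_sub, sub_mul, Finset.sum_sub_distrib, this]
    have h1 : ∑ k, z k * (h k - Matrix.mulVec F h k) = 1 := by
      rw [hdual]
      simp only [hzFk, sub_mul, Finset.sum_sub_distrib, Pi.single_apply, ite_mul, one_mul,
        zero_mul, Finset.sum_ite_eq', Finset.mem_univ, if_true, hhi, hhj,
        sub_zero]
    have h2 : ∑ k, p k * (h k - Matrix.mulVec F h k) = 0 := by
      rw [hdual, hp.1]
      simp
    -- The weight is nonnegative and vanishes at `j`, and h - Fh ≤ 0 away from `i` and `j`. Only the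
    -- term at `i` survives in the upper bound `h4`.
    have h3 : ∑ k, (z j * p k - z k * p j) * (h k - Matrix.mulVec F h k) = -p j := by
      calc _ = z j * ∑ k, p k * (h k - Matrix.mulVec F h k) -
            p j * ∑ k, z k * (h k - Matrix.mulVec F h k) := by
            rw [Finset.mul_sum, Finset.mul_sum, ← Finset.sum_sub_distrib]
            exact Finset.sum_congr rfl fun k _ => by ring
        _ = -p j := by rw [h1, h2]; ring
    have h4 : ∑ k, (z j * p k - z k * p j) * (h k - Matrix.mulVec F h k) ≤
        ∑ k, (Pi.single i (z j * p i * -Matrix.mulVec F h i) : n → ℝ) k := by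
      refine Finset.sum_le_sum fun k _ => ?_
      by_cases hki : k = i
      · subst hki
        rw [Pi.single_eq_same, hzi, hhi]
        apply le_of_eq
        ring
      rw [Pi.single_eq_of_ne hki]
      by_cases hkj : k = j
      · rw [hkj]
        apply le_of_eq
        ring
      · exact mul_nonpos_of_nonneg_of_nonpos (sub_nonneg.2 (hzj k))
          (sub_nonpos.2 ((hsub k hki hkj).trans (hSh k)))
    rw [h3, Finset.sum_pi_single'] at h4
    simp only [Finset.mem_univ, if_true] at h4
    rw [le_div_iff₀ hc]
    have h5 := mul_le_mul_of_nonneg_right (hrh.trans (hSh i)) hc.le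
    linarith
  have hM : 0 ≤ z j / p j := div_nonneg (hz0 j) (hpos j).le
  have hzM : ∀ k, z k ≤ z j / p j * p k := fun k => by
    rw [div_mul_eq_mul_div, le_div_iff₀ (hpos j)]
    exact hzj k
  -- Recentering to zero sum costs no factor: both z_k and (∑ z) p_k lie between 0 and (z_j / p_j)
  -- p_k.
  refine ⟨z - (∑ k, z k) • p, ?_, ?_, fun k => ?_⟩
  · simp only [Pi.sub_apply, Pi.smul_apply, smul_eq_mul]
    rw [Finset.sum_sub_distrib, ← Finset.mul_sum, hp.2]
    ring
  · rw [← hzF, Matrix.sub_vecMul, Matrix.smul_vecMul, hp.1]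
    abel
  · have hZ0 : 0 ≤ ∑ k, z k := Finset.sum_nonneg fun k _ => hz0 k
    have hZM : ∑ k, z k ≤ z j / p j := by
      calc ∑ k, z k ≤ ∑ k, z j / p j * p k := Finset.sum_le_sum fun k _ => hzM k
        _ = z j / p j := by rw [← Finset.mul_sum, hp.2, mul_one]
    have habs : |(z - (∑ k, z k) • p) k| ≤ z j / p j * p k := by
      simp only [Pi.sub_apply, Pi.smul_apply, smul_eq_mul]
      have h1 := mul_le_mul_of_nonneg_right hZM (hpos k).le
      have h2 := mul_nonneg hZ0 (hpos k).le
      rw [abs_le]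
      constructor <;> linarith [hz0 k, hzM k]
    rcases le_total (p i * q) 0 with hneg | hnn
    · exact (mul_nonpos_of_nonneg_of_nonpos (abs_nonneg _) hneg).trans (hpos k).le
    · refine (mul_le_mul_of_nonneg_right habs hnn).trans ?_
      have : z j / p j * p k * (p i * q) = z j * (p i * q) / p j * p k := by ring
      rw [this]
      exact mul_le_of_le_one_left (hpos k).le ((div_le_one (hpos j)).2 hcap)

end LinearAlgebra

/-! ### From the Green bound to the logarithmic perturbation bound -/

section Perturbation

variable {n : Type*} [Fintype n] [DecidableEq n]

/-- The right-hand side of the perturbation bound. -/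
noncomputable def weightedDist (q : n → n → ℝ) (F F' : Matrix n n ℝ) : ℝ :=
  ∑ i, ∑ j ∈ Finset.univ.filter (fun j => i ≠ j), (q i j)⁻¹ * |F' i j - F i j|

theorem weightedDist_nonneg {q : n → n → ℝ} (hq0 : ∀ i j, i ≠ j → 0 < q i j)
    (F F' : Matrix n n ℝ) : 0 ≤ weightedDist q F F' :=
  Finset.sum_nonneg fun i _ => Finset.sum_nonneg fun j hj =>
    mul_nonneg (inv_nonneg.2 (hq0 i j (Finset.mem_filter.1 hj).2).le) (abs_nonneg _)

theorem weightedDist_comm (q : n → n → ℝ) (F F' : Matrix n n ℝ) :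
    weightedDist q F F' = weightedDist q F' F := by
  simp only [weightedDist, abs_sub_comm]

variable [Nonempty n]

theorem abs_sub_le_of_isEscapeBound {S F F' : Matrix n n ℝ} (hF : F ∈ Matrix.rowStochastic ℝ n)
    (hF' : F' ∈ Matrix.rowStochastic ℝ n) (hirr : F.IsIrreducible)
    (hSF : ∀ i j, S i j ≤ F i j) {p p' : n → ℝ}
    (hp : IsInvariantDistribution F p) (hp' : IsInvariantDistribution F' p')
    {q : n → n → ℝ} (hq0 : ∀ i j, i ≠ j → 0 < q i j)
    (hq : ∀ i j, i ≠ j → IsEscapeBound S i j (q i j)) {ρ : ℝ} (hρ : ∀ i, |p' i| ≤ ρ * p i)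
    (m : n) : |p' m - p m| ≤ p m * (ρ * weightedDist q F F') := by
  have hpos := hp.pos hF hirr
  -- The diagonal gets the zero vector, so that `y` is defined for all pairs and double sums run
  -- over everything.
  have hgreen : ∀ i j, ∃ y : n → ℝ, ∑ k, y k = 0 ∧
      y - Matrix.vecMul y F = Pi.single j 1 - Pi.single i 1 ∧
      (i = j → y = 0) ∧ (i ≠ j → ∀ k, |y k| * (p i * q i j) ≤ p k) := by
    intro i j
    by_cases hij : i = j
    · exact ⟨0, by simp, by simp [hij], fun _ => rfl, fun h => absurd hij h⟩
    · obtain ⟨y, h1, h2, h3⟩ := exists_green hF hirr hSF hp hij (hq i j hij)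
      exact ⟨y, h1, h2, fun h => absurd h hij, fun _ => h3⟩
  choose y hy0 hyF hyeq hyle using hgreen
  have hDsum : ∀ i, ∑ j, (F' i j - F i j) = 0 := fun i => by
    rw [Finset.sum_sub_distrib, Matrix.sum_row_of_mem_rowStochastic hF,
      Matrix.sum_row_of_mem_rowStochastic hF', sub_self]
  -- The difference of the two sides of the perturbation formula is `F`-invariant with zero sum,
  -- hence zero.
  have hx : p' - p - ∑ i, ∑ j, (p' i * (F' i j - F i j)) • y i j = 0 := by
    refine eq_zero_of_vecMul_eq_of_sum_eq_zero hF hirr (sub_eq_zero.1 ?_).symm ?_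
    · have h1 : ∑ i, ∑ j, (p' i * (F' i j - F i j)) • (y i j - Matrix.vecMul (y i j) F) =
          p' - Matrix.vecMul p' F := by
        funext k
        simp only [hyF, Finset.sum_apply, Pi.smul_apply, Pi.sub_apply, smul_eq_mul, mul_sub]
        have h2 : p' k = ∑ i, p' i * F' i k := (congrFun hp'.1 k).symm
        have h3 : Matrix.vecMul p' F k = ∑ i, p' i * F i k := rfl
        rw [h3]
        conv_rhs => rw [h2]
        rw [← Finset.sum_sub_distrib]
        refine Finset.sum_congr rfl fun i _ => ?_
        rw [Finset.sum_sub_distrib, ← Finset.sum_mul, Finset.sum_sub_distrib, ← Finset.mul_sum,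
          ← Finset.mul_sum, Matrix.sum_row_of_mem_rowStochastic hF,
          Matrix.sum_row_of_mem_rowStochastic hF']
        simp [Pi.single_apply]
      have h4 : Matrix.vecMul (∑ i, ∑ j, (p' i * (F' i j - F i j)) • y i j) F =
          ∑ i, ∑ j, (p' i * (F' i j - F i j)) • Matrix.vecMul (y i j) F := by
        simp only [← Matrix.smul_vecMul, Matrix.sum_vecMul]
      rw [Matrix.sub_vecMul, Matrix.sub_vecMul, h4, hp.1]
      simp only [smul_sub, Finset.sum_sub_distrib] at h1
      have := sub_eq_zero.2 h1
      rw [← neg_eq_zero, ← this]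
      abel
    · simp only [Pi.sub_apply, Finset.sum_apply, Pi.smul_apply, smul_eq_mul,
        Finset.sum_sub_distrib, hp.2, hp'.2, sub_self, zero_sub, neg_eq_zero]
      rw [Finset.sum_comm]
      refine Finset.sum_eq_zero fun i _ => ?_
      rw [Finset.sum_comm]
      refine Finset.sum_eq_zero fun j _ => ?_
      rw [← Finset.mul_sum, hy0, mul_zero]
  have hm := congrFun (sub_eq_zero.1 hx) m
  simp only [Pi.sub_apply, Finset.sum_apply, Pi.smul_apply, smul_eq_mul] at hm
  rw [hm, weightedDist, Finset.mul_sum, Finset.mul_sum]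
  refine (Finset.abs_sum_le_sum_abs _ _).trans (Finset.sum_le_sum fun i _ => ?_)
  rw [Finset.mul_sum, Finset.mul_sum, Finset.sum_filter]
  refine (Finset.abs_sum_le_sum_abs _ _).trans (Finset.sum_le_sum fun j _ => ?_)
  split_ifs with hij
  · have hq' := hq0 i j hij
    have h1 : |y i j m| * p i ≤ p m * (q i j)⁻¹ := by
      rw [← div_eq_mul_inv, le_div_iff₀ hq', mul_assoc]
      exact hyle i j hij m
    calc |p' i * (F' i j - F i j) * y i j m| = |p' i| * (|F' i j - F i j| * |y i j m|) := by
          rw [abs_mul, abs_mul, mul_assoc]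
      _ ≤ ρ * p i * (|F' i j - F i j| * |y i j m|) :=
          mul_le_mul_of_nonneg_right (hρ i) (by positivity)
      _ = ρ * |F' i j - F i j| * (|y i j m| * p i) := by ring
      _ ≤ ρ * |F' i j - F i j| * (p m * (q i j)⁻¹) := by
          have hρ0 : 0 ≤ ρ := nonneg_of_mul_nonneg_left ((abs_nonneg _).trans (hρ i)) (hpos i)
          exact mul_le_mul_of_nonneg_left h1 (by positivity)
      _ = p m * (ρ * ((q i j)⁻¹ * |F' i j - F i j|)) := by ring
  · rw [hyeq i j (not_not.1 hij)]
    simp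

/-- Perturbation bound for matrices at weighted distance less than one. -/
theorem log_sub_log_le_div {S F F' : Matrix n n ℝ} (hF : F ∈ Matrix.rowStochastic ℝ n)
    (hF' : F' ∈ Matrix.rowStochastic ℝ n) (hS : S.IsIrreducible)
    (hSF : ∀ i j, S i j ≤ F i j) (hSF' : ∀ i j, S i j ≤ F' i j) {p p' : n → ℝ}
    (hp : IsInvariantDistribution F p) (hp' : IsInvariantDistribution F' p')
    {q : n → n → ℝ} (hq0 : ∀ i j, i ≠ j → 0 < q i j)
    (hq : ∀ i j, i ≠ j → IsEscapeBound S i j (q i j)) (hC : weightedDist q F F' < 1)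
    (m : n) : Real.log (p' m) - Real.log (p m) ≤
      weightedDist q F F' / (1 - weightedDist q F F') := by
  have hirr := isIrreducible_mono hS hSF
  have hpos := hp.pos hF hirr
  have hpos' := hp'.pos hF' (isIrreducible_mono hS hSF')
  set C := weightedDist q F F' with hCdef
  obtain ⟨i₀, hi₀⟩ := Finite.exists_max fun k => p' k / p k
  set ρ := p' i₀ / p i₀ with hρdef
  have hρ : ∀ i, p' i ≤ ρ * p i := fun i => (div_le_iff₀ (hpos i)).1 (hi₀ i)
  have h1 := (le_abs_self _).trans (abs_sub_le_of_isEscapeBound hF hF' hirr hSF hp hp' hq0 hq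
    (fun i => (abs_of_pos (hpos' i)).trans_le (hρ i)) i₀)
  have h2 : p' i₀ = ρ * p i₀ := by rw [hρdef, div_mul_cancel₀ _ (hpos i₀).ne']
  rw [h2, ← hCdef] at h1
  -- At the maximizer `i₀` the estimate reads ρ - 1 ≤ ρ C after division by p_{i₀}.
  have h3 : ρ * (1 - C) ≤ 1 := by
    refine le_of_mul_le_mul_right ?_ (hpos i₀)
    linarith
  have hC' : 0 < 1 - C := sub_pos.2 hC
  have h4 : p' m * (1 - C) ≤ p m := by
    calc p' m * (1 - C) ≤ ρ * p m * (1 - C) := mul_le_mul_of_nonneg_right (hρ m) hC'.le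
      _ = ρ * (1 - C) * p m := by ring
      _ ≤ 1 * p m := mul_le_mul_of_nonneg_right h3 (hpos m).le
      _ = p m := one_mul _
  have h5 := Real.log_le_log (mul_pos (hpos' m) hC') h4
  rw [Real.log_mul (hpos' m).ne' hC'.ne'] at h5
  have h6 := Real.one_sub_inv_le_log_of_pos hC'
  have h7 : C / (1 - C) = -(1 - (1 - C)⁻¹) := by field_simp; ring
  rw [h7]
  linarith

/-- The one-step bound C/(1 - C) is sharp to first order only, so it is applied on N equal pieces of
the segment from `F` to `F'` and telescoped. This also removes the restriction C < 1. -/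
theorem log_sub_log_le_weightedDist {S F F' : Matrix n n ℝ} (hF : F ∈ Matrix.rowStochastic ℝ n)
    (hF' : F' ∈ Matrix.rowStochastic ℝ n) (hS : S.IsIrreducible)
    (hSF : ∀ i j, S i j ≤ F i j) (hSF' : ∀ i j, S i j ≤ F' i j) {p p' : n → ℝ}
    (hp : IsInvariantDistribution F p) (hp' : IsInvariantDistribution F' p')
    {q : n → n → ℝ} (hq0 : ∀ i j, i ≠ j → 0 < q i j)
    (hq : ∀ i j, i ≠ j → IsEscapeBound S i j (q i j)) (m : n) :
    Real.log (p' m) - Real.log (p m) ≤ weightedDist q F F' := by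
  set C := weightedDist q F F' with hC
  set G : ℝ → Matrix n n ℝ := fun t => (1 - t) • F + t • F' with hG
  have hGst : ∀ t ∈ Set.Icc (0 : ℝ) 1, G t ∈ Matrix.rowStochastic ℝ n := fun t ht =>
    Matrix.convex_rowStochastic hF hF' (sub_nonneg.2 ht.2) ht.1 (by ring)
  have hGS : ∀ t ∈ Set.Icc (0 : ℝ) 1, ∀ i j, S i j ≤ G t i j := by
    intro t ht i j
    have h1 := mul_le_mul_of_nonneg_left (hSF i j) (sub_nonneg.2 ht.2)
    have h2 := mul_le_mul_of_nonneg_left (hSF' i j) ht.1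
    simp only [hG, Matrix.add_apply, Matrix.smul_apply, smul_eq_mul]
    linarith
  have hex : ∀ t, ∃ v, t ∈ Set.Icc (0 : ℝ) 1 → IsInvariantDistribution (G t) v := by
    intro t
    by_cases ht : t ∈ Set.Icc (0 : ℝ) 1
    · obtain ⟨v, hv, -⟩ := existsUnique_isInvariantDistribution (hGst t ht)
        (isIrreducible_mono hS (hGS t ht))
      exact ⟨v, fun _ => hv⟩
    · exact ⟨0, fun h => absurd h ht⟩
  choose v hv using hex
  have hdist : ∀ s t, s ≤ t → weightedDist q (G s) (G t) = (t - s) * C := by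
    intro s t hst
    simp only [hC, weightedDist, Finset.mul_sum]
    refine Finset.sum_congr rfl fun i _ => Finset.sum_congr rfl fun j _ => ?_
    have : G t i j - G s i j = (t - s) * (F' i j - F i j) := by
      simp only [hG, Matrix.add_apply, Matrix.smul_apply, smul_eq_mul]
      ring
    rw [this, abs_mul, abs_of_nonneg (sub_nonneg.2 hst)]
    ring
  have hC0 : 0 ≤ C := weightedDist_nonneg hq0 F F'
  have hend : Real.log (p' m) - Real.log (p m) = Real.log (v 1 m) - Real.log (v 0 m) := by
    have e1 := (existsUnique_isInvariantDistribution hF' (isIrreducible_mono hS hSF')).unique hp'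
      (by simpa [hG] using hv 1 (by simp))
    have e0 := (existsUnique_isInvariantDistribution hF (isIrreducible_mono hS hSF)).unique hp
      (by simpa [hG] using hv 0 (by simp))
    rw [e1, e0]
  have hbound : ∀ N : ℕ, C < N →
      Real.log (p' m) - Real.log (p m) ≤ C / (1 - C / N) := by
    intro N hN
    have hN0 : (0 : ℝ) < N := hC0.trans_lt hN
    have hmem : ∀ k ≤ N, (k : ℝ) / N ∈ Set.Icc (0 : ℝ) 1 := fun k hk =>
      ⟨by positivity, (div_le_one hN0).2 (Nat.cast_le.2 hk)⟩
    have hstep : ∀ k ∈ Finset.range N, Real.log (v (((k + 1 : ℕ) : ℝ) / N) m) -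
        Real.log (v ((k : ℝ) / N) m) ≤ (C / N) / (1 - C / N) := by
      intro k hk
      have hk' := Finset.mem_range.1 hk
      have hd : weightedDist q (G ((k : ℝ) / N)) (G (((k + 1 : ℕ) : ℝ) / N)) = C / N := by
        rw [hdist _ _ (by gcongr; exact Nat.le_succ k)]
        push_cast
        field_simp
        ring
      have := log_sub_log_le_div (hGst _ (hmem k hk'.le)) (hGst _ (hmem (k + 1) hk')) hS
        (hGS _ (hmem k hk'.le)) (hGS _ (hmem (k + 1) hk')) (hv _ (hmem k hk'.le))
        (hv _ (hmem (k + 1) hk')) hq0 hq (by rw [hd]; exact (div_lt_one hN0).2 hN) m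
      rwa [hd] at this
    have hsum := Finset.sum_le_sum hstep
    rw [Finset.sum_range_sub (fun k : ℕ => Real.log (v ((k : ℝ) / N) m))] at hsum
    simp only [Finset.sum_const, Finset.card_range, nsmul_eq_mul, Nat.cast_zero, zero_div,
      div_self hN0.ne'] at hsum
    rw [hend]
    refine hsum.trans (le_of_eq ?_)
    rw [← mul_div_assoc, mul_div_cancel₀ _ hN0.ne']
  have hlim : Filter.Tendsto (fun N : ℕ => C / (1 - C / N)) Filter.atTop (nhds C) := by
    have h1 := tendsto_const_div_atTop_nhds_zero_nat C
    have h2 := (tendsto_const_nhds (x := C)).div (h1.const_sub 1) (by norm_num)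
    rw [sub_zero, div_one] at h2
    exact h2
  refine ge_of_tendsto hlim ?_
  obtain ⟨N₀, hN₀⟩ := exists_nat_gt C
  filter_upwards [Filter.eventually_ge_atTop N₀] with N hN
  exact hbound N (hN₀.trans_le (Nat.cast_le.2 hN))

end Perturbation

/-! ### Path probabilities with taboo states -/

/-- The event that the chain avoids `B` at the times `1, …, m` and is at `y` at time `m + 1`. -/
def tabooEvent {X : Type*} (B : Set X) (m : ℕ) (y : X) : Set (ℕ → X) :=
  {x | (∀ s, 1 ≤ s → s ≤ m → x s ∉ B) ∧ x (m + 1) = y}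

theorem measurableSet_tabooEvent {X : Type*} [MeasurableSpace X] [DiscreteMeasurableSpace X]
    (B : Set X) (m : ℕ) (y : X) : MeasurableSet (tabooEvent B m y) := by
  have h : tabooEvent B m y =
      (⋂ s, ⋂ (_ : 1 ≤ s), ⋂ (_ : s ≤ m), (fun x : ℕ → X => x s) ⁻¹' Bᶜ) ∩
        (fun x : ℕ → X => x (m + 1)) ⁻¹' {y} := by
    ext x
    simp [tabooEvent]
  rw [h]
  refine MeasurableSet.inter (MeasurableSet.iInter fun s => MeasurableSet.iInter fun _ =>
    MeasurableSet.iInter fun _ => ?_) ?_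
  · exact measurable_pi_apply s MeasurableSet.of_discrete
  · exact measurable_pi_apply (m + 1) MeasurableSet.of_discrete

section Law

variable {X : Type*} [Fintype X] [DecidableEq X] [MeasurableSpace X] [DiscreteMeasurableSpace X]

instance instIsProbabilityMeasureChainLaw (P : Matrix X X ℝ)
    (hP : P ∈ Matrix.rowStochastic ℝ X) (x₀ : X) : IsProbabilityMeasure (chainLaw P hP x₀) := by
  unfold chainLaw
  infer_instance

theorem transitionKernel_singleton (P : Matrix X X ℝ) (hP : P ∈ Matrix.rowStochastic ℝ X)
    (x y : X) : transitionKernel P hP x {y} = ENNReal.ofReal (P x y) := by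
  change (rowPMF P hP x).toMeasure {y} = _
  rw [PMF.toMeasure_apply_singleton _ _ (MeasurableSet.singleton y)]
  rfl

theorem chainLaw_real_one (P : Matrix X X ℝ) (hP : P ∈ Matrix.rowStochastic ℝ X) (x₀ y : X) :
    (chainLaw P hP x₀).real {x | x 1 = y} = P x₀ y := by
  have h : (chainLaw P hP x₀).map (fun x => x (0 + 1)) = transitionKernel P hP x₀ := by
    rw [chainLaw, ← Kernel.map_apply _ (measurable_pi_apply _), Kernel.map_traj_succ_self]
    rfl
  have h2 : (chainLaw P hP x₀) {x | x 1 = y} = ENNReal.ofReal (P x₀ y) := by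
    rw [← transitionKernel_singleton P hP, ← h,
      Measure.map_apply (measurable_pi_apply _) (MeasurableSet.singleton y)]
    rfl
  rw [measureReal_def, h2, ENNReal.toReal_ofReal (Matrix.nonneg_of_mem_rowStochastic hP)]

/-- The Markov property: an event of the past on which the chain is at `k` at time `m`. -/
theorem chainLaw_real_step (P : Matrix X X ℝ) (hP : P ∈ Matrix.rowStochastic ℝ X) (x₀ : X)
    {m : ℕ} (A : Set ((k : Finset.Iic m) → X)) {k : X}
    (hA : ∀ h ∈ A, h ⟨m, Finset.mem_Iic.2 le_rfl⟩ = k) (y : X) :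
    (chainLaw P hP x₀).real {x | Preorder.frestrictLe (π := fun _ => X) m x ∈ A ∧ x (m + 1) = y} =
      (chainLaw P hP x₀).real {x | Preorder.frestrictLe (π := fun _ => X) m x ∈ A} * P k y := by
  have hAm : MeasurableSet A := MeasurableSet.of_discrete
  have h1 := Kernel.partialTraj_compProd_eq_map_traj (X := fun _ => X) (κ := historyKernel P hP) (Nat.zero_le m)
    (x₀ := fun _ => x₀)
  have hmr : Measurable (Preorder.frestrictLe (π := fun _ : ℕ => X) m) :=
    Preorder.measurable_frestrictLe m
  have h2 : (chainLaw P hP x₀)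
      {x | Preorder.frestrictLe (π := fun _ => X) m x ∈ A ∧ x (m + 1) = y} =
      (chainLaw P hP x₀) {x | Preorder.frestrictLe (π := fun _ => X) m x ∈ A} *
        ENNReal.ofReal (P k y) := by
    have e1 : (chainLaw P hP x₀)
        {x | Preorder.frestrictLe (π := fun _ => X) m x ∈ A ∧ x (m + 1) = y} =
        ((Kernel.traj (X := fun _ => X) (historyKernel P hP) 0 (fun _ => x₀)).map
          (fun x => (Preorder.frestrictLe m x, x (m + 1)))) (A ×ˢ {y}) := by
      rw [Measure.map_apply (hmr.prodMk (measurable_pi_apply _))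
        (hAm.prod (MeasurableSet.singleton y))]
      rfl
    have e2 : (chainLaw P hP x₀) {x | Preorder.frestrictLe (π := fun _ => X) m x ∈ A} =
        Kernel.partialTraj (X := fun _ => X) (historyKernel P hP) 0 m (fun _ => x₀) A := by
      rw [← Kernel.traj_map_frestrictLe_apply, Measure.map_apply hmr hAm]
      rfl
    rw [e1, e2, ← h1, Measure.compProd_apply_prod hAm (MeasurableSet.singleton y),
      setLIntegral_congr_fun (g := fun _ => ENNReal.ofReal (P k y)) hAm,
      setLIntegral_const, mul_comm]
    intro h hh
    change transitionKernel P hP (h ⟨m, Finset.mem_Iic.2 le_rfl⟩) {y} = ENNReal.ofReal (P k y)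
    rw [transitionKernel_singleton, hA h hh]
  rw [measureReal_def, h2, ENNReal.toReal_mul,
    ENNReal.toReal_ofReal (Matrix.nonneg_of_mem_rowStochastic hP), measureReal_def]

theorem chainLaw_real_tabooEvent_zero (P : Matrix X X ℝ) (hP : P ∈ Matrix.rowStochastic ℝ X)
    (x₀ : X) (B : Set X) (y : X) : (chainLaw P hP x₀).real (tabooEvent B 0 y) = P x₀ y := by
  rw [← chainLaw_real_one P hP]
  congr 1
  ext x
  simp only [tabooEvent, Set.mem_ofPred_eq]
  exact ⟨fun h => h.2, fun h => ⟨fun s h1 h2 => by omega, h⟩⟩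

-- The event splits disjointly by the state `k` at time m + 1, which must now avoid `B`; the Markov
-- property handles each piece.
open Classical in
theorem chainLaw_real_tabooEvent_succ (P : Matrix X X ℝ) (hP : P ∈ Matrix.rowStochastic ℝ X)
    (x₀ : X) (B : Set X) (m : ℕ) (y : X) :
    (chainLaw P hP x₀).real (tabooEvent B (m + 1) y) =
      ∑ k, if k ∈ B then 0 else (chainLaw P hP x₀).real (tabooEvent B m k) * P k y := by
  have hU : tabooEvent B (m + 1) y = ⋃ k ∈ (Finset.univ.filter fun k => k ∉ B),
      tabooEvent B m k ∩ {x | x (m + 1 + 1) = y} := by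
    ext x
    simp only [tabooEvent, Set.mem_ofPred_eq, Finset.mem_filter, Finset.mem_univ, true_and,
      Set.mem_iUnion, Set.mem_inter_iff, exists_prop]
    constructor
    · rintro ⟨h1, h2⟩
      exact ⟨x (m + 1), h1 _ (by omega) le_rfl, ⟨fun s hs hs' => h1 s hs (by omega), rfl⟩, h2⟩
    · rintro ⟨k, hk, ⟨h1, h2⟩, h3⟩
      refine ⟨fun s hs hs' => ?_, h3⟩
      rcases Nat.lt_or_ge m s with h | h
      · rwa [show s = m + 1 by omega, h2]
      · exact h1 s hs h
  have hy : MeasurableSet ((fun x : ℕ → X => x (m + 1 + 1)) ⁻¹' {y}) :=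
    measurable_pi_apply (m + 1 + 1) (MeasurableSet.singleton y)
  have hms : ∀ k, MeasurableSet (tabooEvent B m k ∩ {x : ℕ → X | x (m + 1 + 1) = y}) := fun k =>
    (measurableSet_tabooEvent B m k).inter hy
  rw [hU, measureReal_biUnion_finset _ (fun k _ => hms k), Finset.sum_filter]
  · refine Finset.sum_congr rfl fun k _ => ?_
    rw [ite_not]
    refine if_congr Iff.rfl rfl ?_
    let A : Set ((k : Finset.Iic (m + 1)) → X) :=
      {h | (∀ s (hs : s ∈ Finset.Iic (m + 1)), 1 ≤ s → s ≤ m → h ⟨s, hs⟩ ∉ B) ∧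
        h ⟨m + 1, Finset.mem_Iic.2 le_rfl⟩ = k}
    have hA : ∀ x : ℕ → X,
        Preorder.frestrictLe (π := fun _ => X) (m + 1) x ∈ A ↔ x ∈ tabooEvent B m k := by
      intro x
      refine and_congr ⟨fun h s hs hs' => h s (Finset.mem_Iic.2 (by omega)) hs hs',
        fun h s _ hs hs' => h s hs hs'⟩ Iff.rfl
    have := chainLaw_real_step P hP x₀ A (k := k) (fun h hh => hh.2) y
    simp only [hA] at this
    exact this
  · intro k _ l _ hkl
    refine Set.disjoint_left.2 fun x hx hx' => hkl ?_
    exact hx.1.2.symm.trans hx'.1.2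

end Law

/-! ### Return times expressed by taboo events -/

section ReturnTime

variable {X : Type*}

theorem returnTime_le_iff (k : X) (x : ℕ → X) (m : ℕ) :
    returnTime k x ≤ WithTop.some m ↔ ∃ s, 1 ≤ s ∧ s ≤ m ∧ x s = k := by
  rw [returnTime, hittingAfter_le_iff]
  simp only [Set.mem_Icc, Set.mem_singleton_iff, and_assoc]

/-- The target `a` belongs to the taboo set, so the m-th event says that the first visit to `a` is
at time m + 1. This makes the union disjoint. -/
theorem setOf_returnTime_lt_eq_iUnion {a b c : X} (hba : b ≠ a) (hca : c ≠ a) :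
    {x : ℕ → X | returnTime a x < min (returnTime b x) (returnTime c x)} =
      ⋃ m, tabooEvent {b, a, c} m a := by
  ext x
  simp only [Set.mem_ofPred_eq, Set.mem_iUnion, lt_min_iff]
  constructor
  · rintro ⟨hb, hc⟩
    obtain ⟨N, hN⟩ := WithTop.ne_top_iff_exists.1 hb.ne_top
    obtain ⟨s, hs1, hsN, hs⟩ := (returnTime_le_iff a x N).1 hN.ge
    have hmin : ∀ t, 1 ≤ t → x t = a → N ≤ t := fun t ht hta => by
      have := (returnTime_le_iff a x t).2 ⟨t, ht, le_rfl, hta⟩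
      rw [← hN] at this
      exact WithTop.coe_le_coe.1 this
    have hother : ∀ d, returnTime a x < returnTime d x → ∀ t, 1 ≤ t → t ≤ N → x t ≠ d :=
      fun d hd t ht htN htd => by
        have := (returnTime_le_iff d x N).2 ⟨t, ht, htN, htd⟩
        rw [hN] at this
        exact absurd hd (not_lt.2 this)
    obtain rfl : s = N := le_antisymm hsN (hmin s hs1 hs)
    obtain ⟨m, rfl⟩ := Nat.exists_eq_add_of_le' hs1
    refine ⟨m, fun t ht htm hB => ?_, hs⟩
    rcases hB with h | h | h
    · exact hother b hb t ht (by omega) h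
    · have := hmin t ht h
      omega
    · exact hother c hc t ht (by omega) h
  · rintro ⟨m, hm, hma⟩
    have ha := (returnTime_le_iff a x (m + 1)).2 ⟨m + 1, by omega, le_rfl, hma⟩
    have hother : ∀ d ∈ ({b, a, c} : Set X), d ≠ a → returnTime a x < returnTime d x := by
      intro d hd hda
      refine ha.trans_lt (not_le.1 fun h => ?_)
      obtain ⟨s, hs1, hs, hsd⟩ := (returnTime_le_iff d x (m + 1)).1 h
      rcases Nat.lt_or_ge m s with h' | h'
      · rw [show s = m + 1 by omega, hma] at hsd
        exact hda hsd.symm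
      · exact hm s hs1 h' (hsd ▸ hd)
    exact ⟨hother b (by simp) hba, hother c (by simp) hca⟩

theorem pairwise_disjoint_tabooEvent {B : Set X} {a : X} (ha : a ∈ B) :
    Pairwise (Function.onFun Disjoint fun m => tabooEvent B m a) := by
  have key : ∀ m l, m < l → Disjoint (tabooEvent B m a) (tabooEvent B l a) := by
    intro m l hml
    refine Set.disjoint_left.2 fun x hx hx' => hx'.1 (m + 1) (by omega) (by omega) ?_
    rw [hx.2]
    exact ha
  intro m l hml
  rcases lt_or_gt_of_ne hml with h | h
  · exact key m l h
  · exact (key l m h).symm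

end ReturnTime

/-! ### Series for the escape probability, its test functions and its positivity -/

section Escape

variable {L : ℕ}

/-- The matrix `S` with the rows `i` and `j` replaced by zero. -/
def killRows (S : Matrix (Fin L) (Fin L) ℝ) (i j : Fin L) : Matrix (Fin L) (Fin L) ℝ :=
  Matrix.of fun k l => if k = i ∨ k = j then 0 else S k l

/-- Erasing the rows `i` and `j` forbids leaving those states at times 1, …, m. The leading factor
keeps the full `S` because the start at `i` is at time 0, and paths through ω are excluded by the
taboo. -/
theorem chainLaw_real_tabooEvent_augmented {S : Matrix (Fin L) (Fin L) ℝ}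
    (hS : IsSubstochastic S) (i j : Fin L) (m : ℕ) (y : Fin L) :
    (chainLaw (augmented S) (augmented_mem_rowStochastic hS) (Sum.inl i)).real
      (tabooEvent {Sum.inl i, Sum.inl j, Sum.inr ()} m (Sum.inl y)) =
      (S * killRows S i j ^ m) i y := by
  classical
  induction m generalizing y with
  | zero =>
    rw [chainLaw_real_tabooEvent_zero, pow_zero, mul_one]
    rfl
  | succ m ih =>
    rw [chainLaw_real_tabooEvent_succ, Fintype.sum_sum_type, pow_succ, ← mul_assoc,
      Matrix.mul_apply]
    simp only [ih, Set.mem_insert_iff, Set.mem_singleton_iff, Sum.inl.injEq, reduceCtorEq,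
      or_false, false_or, Finset.univ_unique, Finset.sum_singleton, if_true,
      add_zero, PUnit.default_eq_unit]
    refine Finset.sum_congr rfl fun k _ => ?_
    simp only [killRows, Matrix.of_apply, mul_ite, mul_zero]
    rfl

theorem hasSum_Q {S : Matrix (Fin L) (Fin L) ℝ} (hS : IsSubstochastic S) {i j : Fin L}
    (hij : i ≠ j) : HasSum (fun m => (S * killRows S i j ^ m) i j) (Q S hS i j) := by
  simp only [← chainLaw_real_tabooEvent_augmented hS]
  rw [Q, setOf_returnTime_lt_eq_iUnion (by simpa using hij) (by simp), measureReal_def,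
    measure_iUnion (pairwise_disjoint_tabooEvent (by simp))
      (fun m => measurableSet_tabooEvent _ m _), ENNReal.tsum_toReal_eq fun _ => measure_ne_top _ _]
  refine ENNReal.hasSum_toReal ?_
  rw [← measure_iUnion (pairwise_disjoint_tabooEvent (by simp))
      (fun m => measurableSet_tabooEvent _ m _)]
  exact measure_ne_top _ _

/-- The probability that the chain killed outside `S`, started at `k`, is at `j` after fewer than
`N` steps, before visiting `i`. -/
noncomputable def hitVec (S : Matrix (Fin L) (Fin L) ℝ) (i j : Fin L) (N : ℕ) (k : Fin L) : ℝ :=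
  ∑ m ∈ Finset.range N, (killRows S i j ^ m) k j

theorem mulVec_hitVec (S : Matrix (Fin L) (Fin L) ℝ) (i j : Fin L) (N : ℕ) :
    Matrix.mulVec S (hitVec S i j N) i =
      ∑ m ∈ Finset.range N, (S * killRows S i j ^ m) i j := by
  simp only [Matrix.mulVec, dotProduct, hitVec, Finset.mul_sum, Matrix.mul_apply]
  exact Finset.sum_comm

theorem hitVec_succ (S : Matrix (Fin L) (Fin L) ℝ) (i j : Fin L) (N : ℕ) (k : Fin L) :
    hitVec S i j (N + 1) k = (if k = i ∨ k = j then 0 else Matrix.mulVec S (hitVec S i j N) k) +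
      (1 : Matrix (Fin L) (Fin L) ℝ) k j := by
  rw [hitVec, Finset.sum_range_succ', pow_zero]
  congr 1
  simp only [pow_succ', Matrix.mul_apply]
  rw [Finset.sum_comm]
  split_ifs with h
  · simp [killRows, h]
  · simp only [← Finset.mul_sum, killRows, Matrix.of_apply, if_neg h]
    rfl

theorem killRows_pow_nonneg {S : Matrix (Fin L) (Fin L) ℝ} (hS : ∀ i j, 0 ≤ S i j)
    (i j : Fin L) (m : ℕ) : ∀ k l, 0 ≤ (killRows S i j ^ m) k l := by
  induction m with
  | zero =>
    intro k l
    rw [pow_zero, Matrix.one_apply]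
    split_ifs <;> norm_num
  | succ m ih =>
    intro k l
    rw [pow_succ, Matrix.mul_apply]
    refine Finset.sum_nonneg fun a _ => mul_nonneg (ih k a) ?_
    simp only [killRows, Matrix.of_apply]
    split_ifs
    · exact le_rfl
    · exact hS a l

theorem hitVec_nonneg {S : Matrix (Fin L) (Fin L) ℝ} (hS : ∀ i j, 0 ≤ S i j)
    (i j : Fin L) (N : ℕ) (k : Fin L) : 0 ≤ hitVec S i j N k :=
  Finset.sum_nonneg fun m _ => killRows_pow_nonneg hS i j m k j

theorem hitVec_le_succ {S : Matrix (Fin L) (Fin L) ℝ} (hS : ∀ i j, 0 ≤ S i j)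
    (i j : Fin L) (N : ℕ) (k : Fin L) : hitVec S i j N k ≤ hitVec S i j (N + 1) k := by
  rw [hitVec, hitVec, Finset.sum_range_succ]
  exact le_add_of_nonneg_right (killRows_pow_nonneg hS i j N k j)

theorem hitVec_eq_zero {S : Matrix (Fin L) (Fin L) ℝ} {i j : Fin L} (hij : i ≠ j) (N : ℕ) :
    hitVec S i j N i = 0 := by
  cases N with
  | zero => simp [hitVec]
  | succ N => simp [hitVec_succ, hij]

theorem tendsto_mulVec_hitVec {S : Matrix (Fin L) (Fin L) ℝ} (hS : IsSubstochastic S)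
    {i j : Fin L} (hij : i ≠ j) :
    Filter.Tendsto (fun N => Matrix.mulVec S (hitVec S i j N) i) Filter.atTop
      (nhds (Q S hS i j)) := by
  simp only [mulVec_hitVec]
  exact (hasSum_Q hS hij).tendsto_sum_nat

/-- The truncated hitting probabilities satisfy the first-step recursion with a shift in N. As they
increase with N, they are subharmonic away from `i` and `j`. -/
theorem isEscapeBound_Q {S : Matrix (Fin L) (Fin L) ℝ} (hS : IsSubstochastic S)
    {i j : Fin L} (hij : i ≠ j) : IsEscapeBound S i j (Q S hS i j) := by
  intro r hr
  obtain ⟨N, hN1, hN⟩ := ((Filter.eventually_ge_atTop 1).and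
    ((tendsto_mulVec_hitVec hS hij).eventually_const_lt hr)).exists
  -- At least one term of the sum is needed for the value 1 at `j`.
  obtain ⟨N, rfl⟩ := Nat.exists_eq_add_of_le' hN1
  refine ⟨hitVec S i j (N + 1), hitVec_nonneg hS.1 i j _, hitVec_eq_zero hij _, ?_, ?_, hN.le⟩
  · simp [hitVec_succ]
  · intro k hki hkj
    refine (hitVec_le_succ hS.1 i j (N + 1) k).trans (le_of_eq ?_)
    rw [hitVec_succ, if_neg (by tauto), Matrix.one_apply_ne hkj, add_zero]

theorem mulVec_hitVec_le_Q {S : Matrix (Fin L) (Fin L) ℝ} (hS : IsSubstochastic S)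
    {i j : Fin L} (hij : i ≠ j) (N : ℕ) : Matrix.mulVec S (hitVec S i j N) i ≤ Q S hS i j := by
  refine Monotone.ge_of_tendsto (monotone_nat_of_le_succ fun N => ?_)
    (tendsto_mulVec_hitVec hS hij) N
  simp only [Matrix.mulVec, dotProduct]
  exact Finset.sum_le_sum fun l _ =>
    mul_le_mul_of_nonneg_left (hitVec_le_succ hS.1 i j N l) (hS.1 i l)

theorem Q_pos {S : Matrix (Fin L) (Fin L) ℝ} (hS : IsSubstochastic S) (hirr : S.IsIrreducible)
    {i j : Fin L} (hij : i ≠ j) : 0 < Q S hS i j := by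
  suffices h : ∃ N, 0 < Matrix.mulVec S (hitVec S i j N) i by
    obtain ⟨N, hN⟩ := h
    exact hN.trans_le (mulVec_hitVec_le_Q hS hij N)
  by_contra! hno
  -- Positivity of the hitting probability passes backwards along edges of `S`. At `i` the recursion
  -- fails, but there the assumption `hno` excludes the case. Along a path from `i` to `j`
  -- positivity would reach `i`, where `hitVec` vanishes.
  have hstep : ∀ k l, 0 < S k l → (∃ N, 0 < hitVec S i j N l) → ∃ N, 0 < hitVec S i j N k := by
    rintro k l hkl ⟨N, hN⟩
    have hpos : 0 < Matrix.mulVec S (hitVec S i j N) k :=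
      (mul_pos hkl hN).trans_le (Finset.single_le_sum (f := fun a => S k a * hitVec S i j N a)
        (fun a _ => mul_nonneg (hS.1 k a) (hitVec_nonneg hS.1 i j N a)) (Finset.mem_univ l))
    by_cases hki : k = i
    · rw [hki] at hpos
      exact absurd hpos (not_lt.2 (hno N))
    by_cases hkj : k = j
    · exact ⟨1, by simp [hitVec_succ, hkj]⟩
    · refine ⟨N + 1, ?_⟩
      rw [hitVec_succ, if_neg (by tauto), Matrix.one_apply_ne hkj, add_zero]
      exact hpos
  have hpath : ∀ k (_ : @Quiver.Path _ S.toQuiver i k), (∃ N, 0 < hitVec S i j N k) →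
      ∃ N, 0 < hitVec S i j N i := by
    intro k p
    induction p with
    | nil => exact id
    | cons p e ih => exact fun h => ih (hstep _ _ e.down h)
  obtain ⟨p, -⟩ := hirr.connected i j
  obtain ⟨N, hN⟩ := hpath j p ⟨1, by simp [hitVec_succ]⟩
  rw [hitVec_eq_zero hij] at hN
  exact lt_irrefl _ hN

end Escape

end MarkovPerturbation

theorem mainTheorem2 {L : ℕ} [NeZero L] (F F' S : Matrix (Fin L) (Fin L) ℝ)
    (hF : F ∈ Matrix.rowStochastic ℝ (Fin L)) (hF' : F' ∈ Matrix.rowStochastic ℝ (Fin L))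
    (hS : MarkovPerturbation.IsSubstochastic S) (hirr : S.IsIrreducible)
    (hFS : ∀ i j, S i j ≤ F i j) (hFS' : ∀ i j, S i j ≤ F' i j) :
    (∃! p, MarkovPerturbation.IsInvariantDistribution F p) ∧
    (∃! p, MarkovPerturbation.IsInvariantDistribution F' p) ∧
    (∀ i j, i ≠ j → 0 < MarkovPerturbation.Q S hS i j) ∧
    ∀ p p' : Fin L → ℝ, MarkovPerturbation.IsInvariantDistribution F p →
      MarkovPerturbation.IsInvariantDistribution F' p' →
      ∀ m, 0 < p m ∧ 0 < p' m ∧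
        |Real.log (p' m) - Real.log (p m)| ≤
          ∑ i, ∑ j ∈ Finset.univ.filter (fun j => i ≠ j),
            (MarkovPerturbation.Q S hS i j)⁻¹ * |F' i j - F i j| := by
  have hFirr := MarkovPerturbation.isIrreducible_mono hirr hFS
  have hFirr' := MarkovPerturbation.isIrreducible_mono hirr hFS'
  have hQ : ∀ i j, i ≠ j → 0 < MarkovPerturbation.Q S hS i j := fun i j hij =>
    MarkovPerturbation.Q_pos hS hirr hij
  have hE : ∀ i j, i ≠ j →
      MarkovPerturbation.IsEscapeBound S i j (MarkovPerturbation.Q S hS i j) := fun i j hij =>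
    MarkovPerturbation.isEscapeBound_Q hS hij
  refine ⟨MarkovPerturbation.existsUnique_isInvariantDistribution hF hFirr,
    MarkovPerturbation.existsUnique_isInvariantDistribution hF' hFirr', hQ, ?_⟩
  intro p p' hp hp' m
  refine ⟨hp.pos hF hFirr m, hp'.pos hF' hFirr' m, abs_sub_le_iff.2 ⟨?_, ?_⟩⟩
  · exact MarkovPerturbation.log_sub_log_le_weightedDist hF hF' hirr hFS hFS' hp hp' hQ hE m
  · refine (MarkovPerturbation.log_sub_log_le_weightedDist hF' hF hirr hFS' hFS hp' hp hQ hE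
      m).trans (le_of_eq ?_)
    exact MarkovPerturbation.weightedDist_comm _ _ _
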